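/- **Model.** There are $N$ users (arms). For each user fix a $K$-state channel with stochastic transition matrix $P$, a stationary distribution $p^s=(p^s_1,\dots,p^s_K)$ of $P$ with $p^s_j>0$ for all $j$, a bounded passive reward function $R(\pi_j^\tau,0)$, $1\le j\le K$, $\tau\in\{1,2,\dots\}$, and an active reward $R^1\in\mathbb R$. The belief state $\pi_j^\tau$ means that the user was last sensed $\tau$ slots ago, in channel state $j$. In the single-arm problem with subsidy $W\in\mathbb R$, the passive action in $\pi_j^\tau$ earns $R(\pi_j^\tau,0)+W$ and leads to $\pi_j^{\tau+1}$; the active action earns $R^1$ and leads to $\pi_k^1$ with probability $p^s_k$. A policy is optimal for $W$ if, from every initial state, it maximizes $\liminf_{T\to\infty}\frac1T\mathbb E[\text{total reward over } T \text{ slots}]$ over all policies. The threshold policy $\Gamma\in(\mathbb N\cup\{0,\infty\})^K$ is passive in $\pi_j^\tau$ if $\tau\le\Gamma_j$ and active otherwise; $\mathcal L(\Gamma)$ is the set of states in which it is passive. For $\Gamma\in(\mathbb N\cup\{0\})^K$ let $\alpha^\Gamma$ be the stationary distribution of the belief state under $\Gamma$, let $E(\Gamma)$ be the stationary mean of the immediate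 reward without subsidy, and let $B(\Gamma)=\sum_{k=1}^K\sum_{r=1}^{\Gamma_k}\alpha^\Gamma(\pi_k^r)$ be the stationary passive probability. An arm is *indexable* if, for all $W<W'$ and every threshold policy $\Gamma$ optimal for $W$: $\mathcal L(\Gamma)\subseteq\mathcal L(\Gamma')$ for some threshold policy $\Gamma'$ optimal for $W'$, and $\mathcal L(\Gamma)\subseteq\mathcal L(\Gamma')$ for every threshold policy $\Gamma'$ with finite entries that is optimal for $W'$. The problem is indexable if all arms are. *Whittle's index* of a state is the smallest $W$ for which the state is indifferent, i.e. some threshold policy optimal for $W$ is passive in it and some threshold policy optimal for $W$ is active in it. **Algorithm** (for one arm). Put $\Gamma^{-1}=(0,\dots,0)$. For $\Gamma\in(\mathbb N\cup\{0,\infty\})^K$ let $\mathcal T(\Gamma)$ be the set of $\Gamma'\in(\mathbb N\cup\{0\})^K$ with $\Gamma'_j\ge\Gamma_j$ for all $j$ and $\Gamma'\ne\Gamma$. Step $i\ge0$ computes $$W_i=\inf_{\Gamma\in\mathcal T(\Gamma^{i-1})}\frac{E(\Gamma^{i-1})-E(\Gamma)}{B(\Gamma)-B(\Gamma^{i-1})},$$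 and $\Gamma^i$ is the largest minimizer, meaning the componentwise supremum of the minimizers in $(\mathbb N\cup\{0,\infty\})^K$ (and $\Gamma^i=\Gamma^{i-1}$ if there is no minimizer, in particular if $\Gamma^{i-1}$ has an infinite entry, so that $\mathcal T(\Gamma^{i-1})=\emptyset$). The step assigns $W(\pi_j^\tau):=W_i$ to all $\pi_j^\tau$ with $\Gamma^{i-1}_j<\tau\le\Gamma^i_j$. The algorithm stops after step $i$ if $\Gamma^i_j=\infty$ for all $j$. **Theorem.** Assume that for every arm and every $W\in\mathbb R$ some threshold policy is optimal, and that for every arm $B(\Gamma)$ is non-decreasing in $\Gamma$. Then the problem is indexable, and for each arm: 1. If step $i$ assigns $W_i$ to $\pi_j^\tau$, then $W_i$ is Whittle's index of $\pi_j^\tau$. 2. If $\Gamma^i_j=\infty$ for all $j$, then each state has been assigned its Whittle index in one of the steps $0,\dots,i$. 3. If all entries of $\Gamma^{i-1}$ are finite, then the infimum in step $i$ is over a non-empty set that is bounded below, and the set of minimizers is closed under componentwise maxima; if moreover it is non-empty and all entries of $\Gamma^i$ are finite, then $\Gamma^i$ is its greatest element. 4. If $R(\pi_j^\tau,0)$ is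 non-increasing in $\tau$ for all $j$, then optimal threshold policies $\Gamma(W)$, $W\in\mathbb R$, can be chosen so that $\mathcal L(\Gamma(W))\subseteq\mathcal L(\Gamma(W'))$ for all $W<W'$, and the infimum in step $i$ is attained whenever all entries of $\Gamma^{i-1}$ are finite. -/

import Mathlib

noncomputable section

/-- Belief states of one user. The pair `(j, τ)` stands for the belief `e_j P ^ τ`: the user was
last sensed `τ ≥ 1` slots ago, and the channel was then in state `j`. -/
abbrev BeliefState (K : ℕ) : Type := Fin K × ℕ+

/-- The data of one user (arm): the transition matrix `P` of its `K`-state channel, the steady-state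
probabilities `ps` of the channel (all positive), the average immediate reward `R0 j τ` of the
passive action in belief state `(j, τ)` (any bounded function), and the average immediate
reward `R1` of the active action. -/
structure Arm (K : ℕ) where
  P : Matrix (Fin K) (Fin K) ℝ
  P_nonneg : ∀ i j, 0 ≤ P i j
  P_row_sum : ∀ i, ∑ j, P i j = 1
  ps : Fin K → ℝ
  ps_pos : ∀ j, 0 < ps j
  ps_sum : ∑ j, ps j = 1
  ps_stationary : Matrix.vecMul ps P = ps
  R0 : Fin K → ℕ+ → ℝ
  R0_bounded : ∃ C : ℝ, ∀ j τ, |R0 j τ| ≤ C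
  R1 : ℝ

/-- A (history dependent, randomized) policy: `act h s` is the probability of choosing the active
action in the current state `s`, when `h` is the list of the earlier states, the latest first.
The earlier states determine the earlier actions: a slot was active iff the next state
has `τ = 1`. -/
structure ArmPolicy (K : ℕ) where
  act : List (BeliefState K) → BeliefState K → ℝ
  act_nonneg : ∀ h s, 0 ≤ act h s
  act_le_one : ∀ h s, act h s ≤ 1

/-- State `(j, τ)` is passive under the threshold vector `Γ` (with values in `ℕ ∪ {∞}`)
iff `τ ≤ Γ j`. -/
def IsPassive {K : ℕ} (Γ : Fin K → ℕ∞) (s : BeliefState K) : Prop :=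
  ((s.2 : ℕ) : ℕ∞) ≤ Γ s.1

/-- The set of belief states in which the threshold policy `Γ` prescribes the passive action. -/
def passiveSet {K : ℕ} (Γ : Fin K → ℕ∞) : Set (BeliefState K) := {s | IsPassive Γ s}

open Classical in
/-- The threshold policy `Γ`: passive in `(j, τ)` if `τ ≤ Γ j`, active otherwise. -/
def thresholdPolicy {K : ℕ} (Γ : Fin K → ℕ∞) : ArmPolicy K where
  act _ s := if IsPassive Γ s then 0 else 1
  act_nonneg _ s := by split_ifs <;> norm_num
  act_le_one _ s := by split_ifs <;> norm_num

/-- A threshold vector with finite entries, as one with entries in `ℕ ∪ {∞}`. -/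
def toExt {K : ℕ} (Γ : Fin K → ℕ) : Fin K → ℕ∞ := fun j => (Γ j : ℕ∞)

namespace Arm

variable {K : ℕ} (A : Arm K)

/-! ### Average reward of a policy, optimal threshold policies -/

/-- Expected total reward over `T` slots, with subsidy `W` for passivity, from the current state `s`
with past `h`. The passive action leads from `(j, τ)` to `(j, τ + 1)`; the active action leads to
`(k, 1)` with probability `ps k`. -/
def totalReward (W : ℝ) (φ : ArmPolicy K) : ℕ → List (BeliefState K) → BeliefState K → ℝ
  | 0, _, _ => 0
  | T + 1, h, s =>
      (1 - φ.act h s) * (A.R0 s.1 s.2 + W + totalReward W φ T (s :: h) (s.1, s.2 + 1))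
        + φ.act h s * (A.R1 + ∑ k, A.ps k * totalReward W φ T (s :: h) (k, 1))

/-- Long-run expected average reward of the policy `φ` from the initial state `s`. -/
def avgReward (W : ℝ) (φ : ArmPolicy K) (s : BeliefState K) : ℝ :=
  Filter.liminf (fun T : ℕ => A.totalReward W φ T [] s / (T : ℝ)) Filter.atTop

/-- The threshold policy `Γ` is optimal, among all policies and from every initial state, for the
average reward problem with subsidy `W`. -/
def IsOptimal (W : ℝ) (Γ : Fin K → ℕ∞) : Prop :=
  ∀ (φ : ArmPolicy K) (s : BeliefState K),
    A.avgReward W φ s ≤ A.avgReward W (thresholdPolicy Γ) s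

/-- For every subsidy, an optimal solution of the single-arm problem is of threshold type. -/
def ThresholdOptimal : Prop := ∀ W : ℝ, ∃ Γ : Fin K → ℕ∞, A.IsOptimal W Γ

/-- Indexability: for `W < W'`, the set of states that are passive under an optimal threshold policy
increases from `W` to `W'`. Every optimal `Γ` for `W` is dominated by some optimal `Γ'` for `W'`,
and by every optimal `Γ'` with finite entries. (If some entry of `Γ'` is infinite, then the arm is
eventually always passive, and the average reward does not determine the finite entries.) -/
def Indexable : Prop :=
  ∀ W W' : ℝ, W < W' → ∀ Γ : Fin K → ℕ∞, A.IsOptimal W Γ →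
    (∃ Γ' : Fin K → ℕ∞, A.IsOptimal W' Γ' ∧ passiveSet Γ ⊆ passiveSet Γ') ∧
    ∀ Γ' : Fin K → ℕ, A.IsOptimal W' (toExt Γ') → passiveSet Γ ⊆ passiveSet (toExt Γ')

/-- With subsidy `W`, optimality leaves the action in state `s` open: some optimal threshold policy
is passive in `s` and some optimal threshold policy is active in `s`. -/
def Indifferent (W : ℝ) (s : BeliefState K) : Prop :=
  (∃ Γ : Fin K → ℕ∞, A.IsOptimal W Γ ∧ IsPassive Γ s) ∧
    ∃ Γ : Fin K → ℕ∞, A.IsOptimal W Γ ∧ ¬ IsPassive Γ s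

/-- `w` is Whittle's index of the state `s`: the smallest subsidy that makes `s` indifferent. -/
def IsWhittleIndex (s : BeliefState K) (w : ℝ) : Prop :=
  IsLeast {W : ℝ | A.Indifferent W s} w

/-! ### Steady state under a threshold policy with finite thresholds -/

open Classical in
/-- One-step transition probability from `s` to `s'` under the threshold policy `Γ`. -/
def trans (Γ : Fin K → ℕ) (s s' : BeliefState K) : ℝ :=
  if IsPassive (toExt Γ) s then (if s' = (s.1, s.2 + 1) then 1 else 0)
  else (if s'.2 = 1 then A.ps s'.1 else 0)

/-- `α` is a stationary probability distribution of the belief state under the policy `Γ`. -/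
def IsStationary (Γ : Fin K → ℕ) (α : BeliefState K → ℝ) : Prop :=
  (∀ s, 0 ≤ α s) ∧ HasSum α 1 ∧ ∀ s', HasSum (fun s => α s * A.trans Γ s s') (α s')

/-- The steady-state distribution `α^Γ` under the threshold policy `Γ`: the distribution that
satisfies `IsStationary`. -/
def steadyState (Γ : Fin K → ℕ) : BeliefState K → ℝ :=
  Classical.epsilon (A.IsStationary Γ)

/-- Stationary probability `∑_k ∑_{r=1}^{Γ_k} α^Γ(k, r)` of the passive action. -/
def passiveProb (Γ : Fin K → ℕ) : ℝ :=
  ∑ k, ∑ r ∈ Finset.range (Γ k), A.steadyState Γ (k, r.succPNat)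

open Classical in
/-- Stationary mean of the immediate reward (without subsidy) under the policy `Γ`. -/
def meanReward (Γ : Fin K → ℕ) : ℝ :=
  ∑' s : BeliefState K,
    A.steadyState Γ s * (if IsPassive (toExt Γ) s then A.R0 s.1 s.2 else A.R1)

/-! ### The algorithm -/

/-- `𝒯(Γ)`: the vectors of natural numbers that are larger than `Γ` (every entry at least as large,
and not equal). It is empty as soon as `Γ` has an infinite entry. -/
def largerThresholds (Γ : Fin K → ℕ∞) : Set (Fin K → ℕ) := {Γ' | Γ < toExt Γ'}

/-- The ratio (reward difference) / (passive-probability difference) of `Γ` and `Γ'`. -/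
def ratio (Γ Γ' : Fin K → ℕ) : ℝ :=
  (A.meanReward Γ - A.meanReward Γ') / (A.passiveProb Γ' - A.passiveProb Γ)

/-- The ratios over which a step that starts from `Γ` takes the infimum. (The set is nonempty only
if all entries of `Γ` are finite, and then `toNat` returns them.) -/
def stepRatios (Γ : Fin K → ℕ∞) : Set ℝ :=
  A.ratio (fun j => (Γ j).toNat) '' largerThresholds Γ

/-- The infimum that is computed in a step that starts from `Γ`. -/
def stepValue (Γ : Fin K → ℕ∞) : ℝ := sInf (A.stepRatios Γ)

/-- The minimizers in a step that starts from `Γ`. -/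
def minimizers (Γ : Fin K → ℕ∞) : Set (Fin K → ℕ) :=
  {Γ' ∈ largerThresholds Γ | A.ratio (fun j => (Γ j).toNat) Γ' = A.stepValue Γ}

/-- The largest minimizer in a step that starts from `Γ`, as a supremum in `(ℕ ∪ {∞})^K`: an entry
is `∞` if that entry is unbounded over the minimizers. (It is `Γ` itself if there is none.) -/
def nextThreshold (Γ : Fin K → ℕ∞) : Fin K → ℕ∞ :=
  Γ ⊔ ⨆ Γ' ∈ A.minimizers Γ, toExt Γ'

/-- The thresholds of the algorithm, with the index shifted by one: `algThreshold 0` is the zero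
vector `Γ^{-1}`, and `algThreshold (i + 1)` is the vector `Γ^i` that step `i` returns. -/
def algThreshold : ℕ → Fin K → ℕ∞
  | 0 => 0
  | i + 1 => A.nextThreshold (algThreshold i)

/-- The value `W_i` that is computed in step `i`, which starts from `Γ^{i-1}`. -/
def algValue (i : ℕ) : ℝ := A.stepValue (A.algThreshold i)

/-- Step `i` of the algorithm assigns its value to `(j, τ)`: `Γ^{i-1}_j < τ ≤ Γ^i_j`. -/
def AssignedAt (i : ℕ) (s : BeliefState K) : Prop :=
  A.algThreshold i s.1 < ((s.2 : ℕ) : ℕ∞) ∧ ((s.2 : ℕ) : ℕ∞) ≤ A.algThreshold (i + 1) s.1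

end Arm

/-- The restless bandit problem is indexable if all its arms are. -/
def ProblemIndexable {N K : ℕ} (arm : Fin N → Arm K) : Prop := ∀ n, (arm n).Indexable

end

/-! An active slot forgets the past, so a threshold policy with finite thresholds runs through
independent cycles: after a sensing in state `k` it collects `R0 k 1, …, R0 k (Γ k)` and then senses
again. One cycle gives the stationary law and the average reward `gain W Γ`. If the optimal average
reward `g` is charged in every slot, an optimal `Γ` maximizes, separately for each `k`, the partial
sums of `R0 k r + (W - g)`. The net subsidy `W - g` is the infimum over `Γ` of `W - gain W Γ`, which
increases with `W`, and adding a larger constant to every term moves the maximizers of the partial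
sums up: this is indexability. No policy does better than the finite thresholds, as seen from the
value function whose value after `n` passive slots is the best gain in partial sums still ahead. A
policy with infinite thresholds is optimal iff staying passive forever on those coordinates earns at
least `g` per slot.

The ratio of `Γ` and `Γ'` is the subsidy at which they have the same gain. So the value of a step is
the largest subsidy for which the current thresholds are optimal, the minimizers are the larger
thresholds that are optimal for the same subsidy, and by monotonicity a state on which the two
disagree is not indifferent for any smaller subsidy. -/

section Thresholds

variable {K : ℕ}

theorem BeliefState.exists_eq_succPNat (s : BeliefState K) :
    ∃ (j : Fin K) (n : ℕ), s = (j, n.succPNat) :=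
  ⟨s.1, s.2.natPred, by rw [PNat.succPNat_natPred]⟩

theorem isPassive_succPNat {Γ : Fin K → ℕ∞} {j : Fin K} {n : ℕ} :
    IsPassive Γ (j, n.succPNat) ↔ (n : ℕ∞) < Γ j := by
  rw [IsPassive, Nat.succPNat_coe, Nat.cast_succ, ENat.add_one_le_iff (ENat.natCast_ne_top n)]

theorem isPassive_toExt {Γ : Fin K → ℕ} {j : Fin K} {n : ℕ} :
    IsPassive (toExt Γ) (j, n.succPNat) ↔ n < Γ j :=
  isPassive_succPNat.trans Nat.cast_lt

theorem act_thresholdPolicy_ne_one {Γ : Fin K → ℕ∞} {l : List (BeliefState K)}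
    {s : BeliefState K} : (thresholdPolicy Γ).act l s ≠ 1 ↔ IsPassive Γ s := by
  simp [thresholdPolicy]

theorem act_thresholdPolicy_ne_zero {Γ : Fin K → ℕ∞} {l : List (BeliefState K)}
    {s : BeliefState K} : (thresholdPolicy Γ).act l s ≠ 0 ↔ ¬ IsPassive Γ s := by
  simp [thresholdPolicy]

theorem toExt_le_toExt {Γ Γ' : Fin K → ℕ} : toExt Γ ≤ toExt Γ' ↔ Γ ≤ Γ' :=
  forall_congr' fun _ => Nat.cast_le

theorem toExt_lt_toExt {Γ Γ' : Fin K → ℕ} : toExt Γ < toExt Γ' ↔ Γ < Γ' := by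
  simp only [lt_iff_le_not_ge, toExt_le_toExt]

theorem exists_eq_toExt {Γ : Fin K → ℕ∞} (h : ∀ j, Γ j ≠ ⊤) : ∃ G : Fin K → ℕ, Γ = toExt G :=
  ⟨fun j => (Γ j).toNat, funext fun j => (ENat.natCast_toNat (h j)).symm⟩

theorem exists_eq_toExt_or_exists_eq_top (Γ : Fin K → ℕ∞) :
    (∃ G : Fin K → ℕ, Γ = toExt G) ∨ ∃ j, Γ j = ⊤ :=
  or_iff_not_imp_right.2 fun h => exists_eq_toExt (not_exists.1 h)

theorem passiveSet_subset_passiveSet {Γ Γ' : Fin K → ℕ∞} :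
    passiveSet Γ ⊆ passiveSet Γ' ↔ Γ ≤ Γ' := by
  refine ⟨fun h j => ENat.forall_natCast_le_iff_le.1 fun n hn => ?_, fun h s hs => hs.trans (h s.1)⟩
  cases n with
  | zero => exact zero_le
  | succ n => exact h (a := (j, n.succPNat)) hn

end Thresholds

section Limits

open Filter Topology

theorem tendsto_mul_add_div (c d : ℝ) :
    Tendsto (fun T : ℕ => (c * T + d) / T) atTop (𝓝 c) := by
  have h : Tendsto (fun T : ℕ => c + d / T) atTop (𝓝 c) := by
    simpa using (tendsto_const_div_atTop_nhds_zero_nat d).const_add c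
  refine h.congr' ?_
  filter_upwards [eventually_ne_atTop 0] with T hT
  rw [add_div, mul_div_cancel_right₀ _ (Nat.cast_ne_zero.2 hT)]

end Limits

namespace Arm

open Filter Finset
open scoped Topology

variable {K : ℕ} {A : Arm K}

theorem nonempty_channelState (A : Arm K) : Nonempty (Fin K) := by
  by_contra! h
  simpa using A.ps_sum

/-! ### Cycles between active slots -/

/-- Expected number of visits to the belief state `s` in a cycle of the threshold policy `Γ`, where
a cycle starts in `(k, 1)` with probability `ps k` and ends with the next active slot. -/
noncomputable def visits (A : Arm K) (Γ : Fin K → ℕ) (s : BeliefState K) : ℝ :=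
  if s.2.natPred ≤ Γ s.1 then A.ps s.1 else 0

/-- Expected length of a cycle of the threshold policy `Γ`. -/
noncomputable def cycleLength (A : Arm K) (Γ : Fin K → ℕ) : ℝ := 1 + ∑ k, A.ps k * Γ k

theorem cycleLength_pos (A : Arm K) (Γ : Fin K → ℕ) : 0 < A.cycleLength Γ :=
  add_pos_of_pos_of_nonneg one_pos <|
    sum_nonneg fun k _ => mul_nonneg (A.ps_pos k).le (Nat.cast_nonneg _)

theorem cycleLength_strictMono (A : Arm K) : StrictMono A.cycleLength := fun Γ Γ' h => by
  obtain ⟨hle, j, hj⟩ := Pi.lt_def.1 h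
  refine add_lt_add_right (sum_lt_sum (fun k _ => ?_) ⟨j, mem_univ j, ?_⟩) _
  · exact mul_le_mul_of_nonneg_left (Nat.cast_le.2 (hle k)) (A.ps_pos k).le
  · exact mul_lt_mul_of_pos_left (Nat.cast_lt.2 hj) (A.ps_pos j)

theorem visits_succPNat (Γ : Fin K → ℕ) (j : Fin K) (n : ℕ) :
    A.visits Γ (j, n.succPNat) = if n ≤ Γ j then A.ps j else 0 :=
  rfl

theorem hasSum_visits_mul (A : Arm K) (Γ : Fin K → ℕ) (f : BeliefState K → ℝ) :
    HasSum (fun s => A.visits Γ s * f s)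
      (∑ k, A.ps k * ∑ n ∈ range (Γ k + 1), f (k, n.succPNat)) := by
  let e : (Σ _ : Fin K, ℕ) ≃ BeliefState K :=
    (Equiv.sigmaEquivProd _ _).trans ((Equiv.refl _).prodCongr Equiv.pnatEquivNat.symm)
  have he : ∀ x, A.visits Γ (e x) * f (e x)
      = (if x.2 ≤ Γ x.1 then A.ps x.1 else 0) * f (x.1, x.2.succPNat) := fun x =>
    congrArg (· * _) (visits_succPNat Γ x.1 x.2)
  have hsum : ∑ k, A.ps k * ∑ n ∈ range (Γ k + 1), f (k, n.succPNat)
      = ∑ x ∈ univ.sigma fun k => range (Γ k + 1), A.visits Γ (e x) * f (e x) := by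
    rw [sum_sigma]
    refine sum_congr rfl fun k _ => (mul_sum _ _ _).trans (sum_congr rfl fun n hn => ?_)
    rw [he, if_pos (Nat.lt_succ_iff.1 (mem_range.1 hn))]
  rw [← e.hasSum_iff, hsum]
  refine hasSum_sum_of_ne_finset_zero fun x hx => ?_
  have hx : ¬ x.2 ≤ Γ x.1 := by simpa [Nat.lt_succ_iff] using hx
  rw [Function.comp_apply, he, if_neg hx, zero_mul]

theorem hasSum_visits (A : Arm K) (Γ : Fin K → ℕ) : HasSum (A.visits Γ) (A.cycleLength Γ) := by
  convert A.hasSum_visits_mul Γ fun _ => 1 using 1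
  · simp only [mul_one]
  · simp [cycleLength, mul_add, sum_add_distrib, A.ps_sum, add_comm]

/-! ### The steady state -/

theorem trans_succ (Γ : Fin K → ℕ) (s : BeliefState K) (k : Fin K) (n : ℕ) :
    A.trans Γ s (k, (n + 1).succPNat) = if s = (k, n.succPNat) ∧ n < Γ k then 1 else 0 := by
  obtain ⟨j, m, rfl⟩ := s.exists_eq_succPNat
  have hne : (n + 1).succPNat ≠ 1 := Nat.succPNat_injective.ne n.succ_ne_zero
  have hnext : ((k, (n + 1).succPNat) : BeliefState K) = (j, m.succPNat + 1) ↔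
      (j, m.succPNat) = (k, n.succPNat) := by
    rw [show m.succPNat + 1 = (m + 1).succPNat from rfl]
    simp [eq_comm]
  simp only [trans, isPassive_toExt, hnext, hne, if_false]
  by_cases h : (j, m.succPNat) = (k, n.succPNat)
  · obtain ⟨rfl, hmn⟩ := Prod.mk.inj h
    obtain rfl := Nat.succPNat_injective hmn
    simp
  · simp [h]

theorem trans_one (Γ : Fin K → ℕ) (i k : Fin K) (m : ℕ) :
    A.trans Γ (i, m.succPNat) (k, 1) = if m < Γ i then 0 else A.ps k := by
  have hne : (1 : ℕ+) ≠ m.succPNat + 1 := Nat.succPNat_injective.ne m.succ_ne_zero.symm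
  simp [trans, isPassive_toExt, hne]

theorem trans_one_eq_mul (Γ : Fin K → ℕ) (s : BeliefState K) (k : Fin K) :
    A.trans Γ s (k, 1) = A.ps k * ∑ i, A.trans Γ s (i, 1) := by
  obtain ⟨j, m, rfl⟩ := s.exists_eq_succPNat
  simp only [trans_one]
  split_ifs <;> simp [A.ps_sum]

theorem hasSum_mul_trans_succ (Γ : Fin K → ℕ) (α : BeliefState K → ℝ) (k : Fin K) (n : ℕ) :
    HasSum (fun s => α s * A.trans Γ s (k, (n + 1).succPNat))
      (if n < Γ k then α (k, n.succPNat) else 0) := by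
  classical
  convert hasSum_single (k, n.succPNat) fun s hs => ?_ using 1
  · simp [trans_succ]
  · simp [trans_succ, hs]

theorem hasSum_visits_mul_trans_one (Γ : Fin K → ℕ) (k : Fin K) :
    HasSum (fun s => A.visits Γ s * A.trans Γ s (k, 1)) (A.ps k) := by
  convert A.hasSum_visits_mul Γ fun s => A.trans Γ s (k, 1)
  have hcycle (i : Fin K) :
      ∑ n ∈ range (Γ i + 1), A.trans Γ (i, n.succPNat) (k, 1) = A.ps k := by
    rw [sum_range_succ, sum_eq_zero fun n hn => by rw [trans_one, if_pos (mem_range.1 hn)],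
      trans_one, if_neg (lt_irrefl _), zero_add]
  simp only [hcycle, ← sum_mul, A.ps_sum, one_mul]

theorem isStationary_visits_div (A : Arm K) (Γ : Fin K → ℕ) :
    A.IsStationary Γ fun s => A.visits Γ s / A.cycleLength Γ := by
  refine ⟨fun s => div_nonneg ?_ (A.cycleLength_pos Γ).le, ?_, fun s => ?_⟩
  · unfold visits
    split_ifs
    exacts [(A.ps_pos _).le, le_rfl]
  · simpa only [div_self (A.cycleLength_pos Γ).ne'] using
      (A.hasSum_visits Γ).div_const (A.cycleLength Γ)
  · suffices h : HasSum (fun t => A.visits Γ t * A.trans Γ t s) (A.visits Γ s) by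
      simpa only [div_mul_eq_mul_div] using h.div_const (A.cycleLength Γ)
    obtain ⟨k, n, rfl⟩ := s.exists_eq_succPNat
    cases n with
    | zero => exact hasSum_visits_mul_trans_one Γ k
    | succ n =>
      convert A.hasSum_mul_trans_succ Γ (A.visits Γ) k n using 1
      simp only [visits_succPNat, Nat.succ_le_iff]
      split_ifs <;> first | rfl | omega

theorem IsStationary.eq_visits_div {Γ : Fin K → ℕ} {α : BeliefState K → ℝ}
    (h : A.IsStationary Γ α) (s : BeliefState K) : α s = A.visits Γ s / A.cycleLength Γ := by
  set c := ∑ i, α (i, 1)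
  have hone (k : Fin K) : α (k, 1) = A.ps k * c := by
    refine (h.2.2 (k, 1)).unique ?_
    have hactive := (hasSum_sum fun i (_ : i ∈ univ) => h.2.2 (i, 1)).mul_left (A.ps k)
    simpa only [← mul_sum, mul_left_comm (A.ps k), ← trans_one_eq_mul] using hactive
  have hα (s : BeliefState K) : α s = A.visits Γ s * c := by
    obtain ⟨k, n, rfl⟩ := s.exists_eq_succPNat
    rw [visits_succPNat]
    induction n with
    | zero => exact hone k
    | succ n ih =>
      rw [(h.2.2 _).unique (A.hasSum_mul_trans_succ Γ α k n), ih]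
      simp only [Nat.succ_le_iff]
      split_ifs <;> first | rfl | exact (zero_mul c).symm | omega
  have htotal : A.cycleLength Γ * c = 1 :=
    ((A.hasSum_visits Γ).mul_right c).unique (by simpa only [← hα] using h.2.1)
  rw [hα, eq_div_iff (A.cycleLength_pos Γ).ne', mul_assoc, mul_comm c, htotal, mul_one]

theorem steadyState_eq (Γ : Fin K → ℕ) (s : BeliefState K) :
    A.steadyState Γ s = A.visits Γ s / A.cycleLength Γ :=
  (Classical.epsilon_spec ⟨_, A.isStationary_visits_div Γ⟩ : A.IsStationary Γ _).eq_visits_div s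

theorem passiveProb_eq (A : Arm K) (Γ : Fin K → ℕ) :
    A.passiveProb Γ = 1 - 1 / A.cycleLength Γ := by
  have hpassive (k : Fin K) :
      ∑ n ∈ range (Γ k), A.steadyState Γ (k, n.succPNat) = A.ps k * Γ k / A.cycleLength Γ := by
    rw [sum_congr rfl fun n hn => by
      rw [steadyState_eq, visits_succPNat, if_pos (mem_range.1 hn).le]]
    rw [sum_const, card_range, nsmul_eq_mul, mul_div_right_comm, mul_comm]
  simp_rw [passiveProb, hpassive]
  rw [← sum_div, one_sub_div (A.cycleLength_pos Γ).ne', cycleLength, add_sub_cancel_left]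

theorem passiveProb_strictMono (A : Arm K) : StrictMono A.passiveProb := fun Γ Γ' h => by
  rw [passiveProb_eq, passiveProb_eq]
  exact sub_lt_sub_left
    (one_div_lt_one_div_of_lt (A.cycleLength_pos Γ) (A.cycleLength_strictMono h)) _

/-! ### The gain of a threshold policy -/

/-- Reward of the first `n` passive slots after the channel was sensed in state `j`, when passivity
is subsidized by `W`. -/
noncomputable def passiveReward (A : Arm K) (W : ℝ) (j : Fin K) (n : ℕ) : ℝ :=
  ∑ r ∈ range n, (A.R0 j r.succPNat + W)

@[simp]
theorem passiveReward_zero (W : ℝ) (j : Fin K) : A.passiveReward W j 0 = 0 :=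
  sum_range_zero _

theorem passiveReward_succ (A : Arm K) (W : ℝ) (j : Fin K) (n : ℕ) :
    A.passiveReward W j (n + 1) = A.passiveReward W j n + (A.R0 j n.succPNat + W) :=
  sum_range_succ _ _

theorem passiveReward_add (W d : ℝ) (j : Fin K) (n : ℕ) :
    A.passiveReward (W + d) j n = A.passiveReward W j n + d * n := by
  simp only [passiveReward, ← add_assoc, sum_add_distrib, sum_const, card_range, nsmul_eq_mul,
    mul_comm]

/-- The average reward of the threshold policy `Γ` with subsidy `W`, computed over one cycle. -/
noncomputable def gain (A : Arm K) (W : ℝ) (Γ : Fin K → ℕ) : ℝ :=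
  (A.R1 + ∑ k, A.ps k * A.passiveReward W k (Γ k)) / A.cycleLength Γ

theorem meanReward_eq (Γ : Fin K → ℕ) : A.meanReward Γ = A.gain 0 Γ := by
  classical
  let r : BeliefState K → ℝ := fun s => if IsPassive (toExt Γ) s then A.R0 s.1 s.2 else A.R1
  have hcycle (k : Fin K) :
      ∑ n ∈ range (Γ k + 1), r (k, n.succPNat) = A.passiveReward 0 k (Γ k) + A.R1 := by
    rw [sum_range_succ, passiveReward]
    refine congrArg₂ _ (sum_congr rfl fun n hn => ?_) (if_neg ?_)
    · simp [r, isPassive_toExt, mem_range.1 hn]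
    · simp [isPassive_toExt]
  have hsum := (A.hasSum_visits_mul Γ r).div_const (A.cycleLength Γ)
  simp only [hcycle, mul_add, sum_add_distrib, ← sum_mul, A.ps_sum, one_mul] at hsum
  rw [gain, add_comm, ← hsum.tsum_eq, meanReward]
  exact tsum_congr fun s => by rw [steadyState_eq, div_mul_eq_mul_div]

theorem gain_eq_meanReward_add (W : ℝ) (Γ : Fin K → ℕ) :
    A.gain W Γ = A.meanReward Γ + W * A.passiveProb Γ := by
  have hreward (k : Fin K) : A.ps k * A.passiveReward W k (Γ k) =
      A.ps k * A.passiveReward 0 k (Γ k) + W * (A.ps k * Γ k) := by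
    rw [← zero_add W, passiveReward_add, zero_add, mul_add, mul_left_comm]
  have hL := (A.cycleLength_pos Γ).ne'
  simp_rw [meanReward_eq, passiveProb_eq, gain, hreward, sum_add_distrib, ← mul_sum]
  rw [one_sub_div hL, mul_div_assoc', ← add_div, cycleLength]
  ring

theorem sub_gain_eq (W : ℝ) (Γ : Fin K → ℕ) :
    W - A.gain W Γ = W / A.cycleLength Γ - A.meanReward Γ := by
  rw [gain_eq_meanReward_add, passiveProb_eq]
  ring

theorem sub_gain_strictMono (A : Arm K) (Γ : Fin K → ℕ) :
    StrictMono fun W => W - A.gain W Γ := fun W W' h => by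
  simp only [sub_gain_eq]
  exact sub_lt_sub_right (div_lt_div_of_pos_right h (A.cycleLength_pos Γ)) _

theorem le_ratio_iff {W : ℝ} {Γ Γ' : Fin K → ℕ} (h : Γ < Γ') :
    W ≤ A.ratio Γ Γ' ↔ A.gain W Γ' ≤ A.gain W Γ := by
  rw [ratio, le_div_iff₀ (sub_pos.2 (A.passiveProb_strictMono h)), gain_eq_meanReward_add,
    gain_eq_meanReward_add]
  constructor <;> intro h <;> linarith

theorem ratio_eq_iff {W : ℝ} {Γ Γ' : Fin K → ℕ} (h : Γ < Γ') :
    A.ratio Γ Γ' = W ↔ A.gain W Γ' = A.gain W Γ := by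
  rw [ratio, div_eq_iff (sub_pos.2 (A.passiveProb_strictMono h)).ne', gain_eq_meanReward_add,
    gain_eq_meanReward_add]
  constructor <;> intro h <;> linarith

/-- Expected reward of a cycle of the threshold policy `Γ` with subsidy `W`, when `v` is charged in
every slot. -/
noncomputable def cycleSurplus (A : Arm K) (W v : ℝ) (Γ : Fin K → ℕ) : ℝ :=
  A.R1 - v + ∑ k, A.ps k * A.passiveReward (W - v) k (Γ k)

theorem cycleSurplus_eq (W v : ℝ) (Γ : Fin K → ℕ) :
    A.cycleSurplus W v Γ = (A.gain W Γ - v) * A.cycleLength Γ := by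
  rw [sub_mul, gain, div_mul_cancel₀ _ (A.cycleLength_pos Γ).ne', cycleSurplus, cycleLength]
  simp only [sub_eq_add_neg W, passiveReward_add, mul_add, sum_add_distrib, mul_left_comm,
    ← mul_sum]
  ring

theorem gain_le_iff {W v : ℝ} {Γ : Fin K → ℕ} : A.gain W Γ ≤ v ↔ A.cycleSurplus W v Γ ≤ 0 := by
  rw [← not_lt, ← not_lt, cycleSurplus_eq, mul_pos_iff_of_pos_right (A.cycleLength_pos Γ), sub_pos]

theorem le_gain_iff {W v : ℝ} {Γ : Fin K → ℕ} : v ≤ A.gain W Γ ↔ 0 ≤ A.cycleSurplus W v Γ := by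
  rw [cycleSurplus_eq, mul_nonneg_iff_of_pos_right (A.cycleLength_pos Γ), sub_nonneg]

theorem cycleSurplus_gain (W : ℝ) (Γ : Fin K → ℕ) : A.cycleSurplus W (A.gain W Γ) Γ = 0 := by
  rw [cycleSurplus_eq, sub_self, zero_mul]

theorem cycleSurplus_update (W v : ℝ) (Γ : Fin K → ℕ) (j : Fin K) (n : ℕ) :
    A.cycleSurplus W v (Function.update Γ j n) = A.cycleSurplus W v Γ +
      A.ps j * (A.passiveReward (W - v) j n - A.passiveReward (W - v) j (Γ j)) := by
  have hother (k : Fin K) (hk : k ∈ univ.erase j) : Function.update Γ j n k = Γ k :=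
    Function.update_of_ne (ne_of_mem_erase hk) _ _
  rw [cycleSurplus, cycleSurplus, ← add_sum_erase _ _ (mem_univ j),
    ← add_sum_erase univ (fun k => A.ps k * A.passiveReward (W - v) k (Γ k)) (mem_univ j),
    sum_congr rfl fun k hk => by rw [hother k hk], Function.update_self]
  ring

/-! ### Bounds on the average reward of a policy -/

/-- Expected value of one slot in the belief state `s`, when the active action is chosen with
probability `a` and `v` is the value of the next state. -/
noncomputable def backup (A : Arm K) (W a : ℝ) (v : BeliefState K → ℝ) (s : BeliefState K) : ℝ :=
  (1 - a) * (A.R0 s.1 s.2 + W + v (s.1, s.2 + 1)) + a * (A.R1 + ∑ k, A.ps k * v (k, 1))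

theorem backup_mono (W : ℝ) {a : ℝ} (h0 : 0 ≤ a) (h1 : a ≤ 1) : Monotone (A.backup W a) :=
  fun _ _ hv s => add_le_add
    (mul_le_mul_of_nonneg_left (add_le_add_right (hv (s.1, s.2 + 1)) _) (sub_nonneg.2 h1))
    (mul_le_mul_of_nonneg_left (add_le_add_right (sum_le_sum fun k _ =>
      mul_le_mul_of_nonneg_left (hv (k, 1)) (A.ps_pos k).le) _) h0)

theorem backup_add_const (W a b : ℝ) (v : BeliefState K → ℝ) (s : BeliefState K) :
    A.backup W a (fun t => v t + b) s = A.backup W a v s + b := by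
  simp only [backup, mul_add, sum_add_distrib, ← sum_mul, A.ps_sum]
  ring

theorem backup_le {W a B : ℝ} {v : BeliefState K → ℝ} {s : BeliefState K} (h0 : 0 ≤ a) (h1 : a ≤ 1)
    (hpassive : a ≠ 1 → A.R0 s.1 s.2 + W + v (s.1, s.2 + 1) ≤ B)
    (hactive : a ≠ 0 → A.R1 + ∑ k, A.ps k * v (k, 1) ≤ B) : A.backup W a v s ≤ B := by
  rcases eq_or_ne a 0 with rfl | ha0
  · simpa [backup] using hpassive zero_ne_one
  rcases eq_or_ne a 1 with rfl | ha1
  · simpa [backup] using hactive one_ne_zero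
  · calc A.backup W a v s
        ≤ (1 - a) * B + a * B := add_le_add
          (mul_le_mul_of_nonneg_left (hpassive ha1) (sub_nonneg.2 h1))
          (mul_le_mul_of_nonneg_left (hactive ha0) h0)
      _ = B := by ring

theorem totalReward_le {W c m : ℝ} {φ : ArmPolicy K} {v : BeliefState K → ℝ} (hm : ∀ s, m ≤ v s)
    (h : ∀ l s, A.backup W (φ.act l s) v s ≤ c + v s) (T : ℕ) (l : List (BeliefState K))
    (s : BeliefState K) : A.totalReward W φ T l s ≤ v s + (c * T - m) := by
  induction T generalizing l s with
  | zero => simpa [totalReward] using hm s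
  | succ T ih =>
    calc A.totalReward W φ (T + 1) l s
        ≤ A.backup W (φ.act l s) (fun t => v t + (c * T - m)) s :=
          backup_mono W (φ.act_nonneg l s) (φ.act_le_one l s) (ih (s :: l)) s
      _ = A.backup W (φ.act l s) v s + (c * T - m) := backup_add_const ..
      _ ≤ c + v s + (c * T - m) := add_le_add_left (h l s) _
      _ = v s + (c * (T + 1 : ℕ) - m) := by push_cast; ring

/-- The arm with all rewards negated. It turns upper bounds on rewards into lower bounds. -/
def neg (A : Arm K) : Arm K :=
  { A with
    R0 := fun j τ => -A.R0 j τ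
    R0_bounded := by simpa only [abs_neg] using A.R0_bounded
    R1 := -A.R1 }

theorem totalReward_neg (W : ℝ) (φ : ArmPolicy K) (T : ℕ) (l : List (BeliefState K))
    (s : BeliefState K) : A.neg.totalReward (-W) φ T l s = -A.totalReward W φ T l s := by
  induction T generalizing l s with
  | zero => simp [totalReward]
  | succ T ih =>
    simp only [totalReward, ih]
    simp only [neg, mul_neg, sum_neg_distrib]
    ring

theorem passiveReward_neg (W : ℝ) (j : Fin K) (n : ℕ) :
    A.neg.passiveReward (-W) j n = -A.passiveReward W j n := by
  simp only [passiveReward, neg, ← sum_neg_distrib, neg_add]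

theorem exists_totalReward_le (A : Arm K) (W : ℝ) :
    ∃ M, ∀ φ T l s, A.totalReward W φ T l s ≤ M * T := by
  obtain ⟨C, hC⟩ := A.R0_bounded
  refine ⟨max (C + W) A.R1, fun φ T l s => ?_⟩
  suffices h : ∀ l s, A.backup W (φ.act l s) 0 s ≤ max (C + W) A.R1 + 0 by
    simpa using A.totalReward_le (fun _ => le_rfl) h T l s
  refine fun l s => backup_le (φ.act_nonneg l s) (φ.act_le_one l s) (fun _ => ?_) fun _ => ?_
  · simpa using .inl (le_of_abs_le (hC s.1 s.2))
  · simp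

theorem isBoundedUnder_le_totalReward_div (A : Arm K) (W : ℝ) (φ : ArmPolicy K)
    (s : BeliefState K) :
    atTop.IsBoundedUnder (· ≤ ·) fun T : ℕ => A.totalReward W φ T [] s / T := by
  obtain ⟨M, hM⟩ := A.exists_totalReward_le W
  refine isBoundedUnder_of_eventually_le (a := M) ?_
  filter_upwards [eventually_gt_atTop 0] with T hT
  exact (div_le_iff₀ (Nat.cast_pos.2 hT)).2 (hM φ T [] s)

theorem isBoundedUnder_ge_totalReward_div (A : Arm K) (W : ℝ) (φ : ArmPolicy K)
    (s : BeliefState K) :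
    atTop.IsBoundedUnder (· ≥ ·) fun T : ℕ => A.totalReward W φ T [] s / T := by
  rw [← isBoundedUnder_le_neg]
  simpa only [totalReward_neg, neg_div] using A.neg.isBoundedUnder_le_totalReward_div (-W) φ s

theorem avgReward_le {W c d : ℝ} {φ : ArmPolicy K} {s : BeliefState K}
    (h : ∀ T : ℕ, A.totalReward W φ T [] s ≤ c * T + d) : A.avgReward W φ s ≤ c :=
  (liminf_le_liminf
    (.of_forall fun T => div_le_div_of_nonneg_right (h T) T.cast_nonneg)
    (A.isBoundedUnder_ge_totalReward_div W φ s)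
    (tendsto_mul_add_div c d).isCoboundedUnder_ge).trans_eq (tendsto_mul_add_div c d).liminf_eq

theorem le_avgReward {W c d : ℝ} {φ : ArmPolicy K} {s : BeliefState K}
    (h : ∀ T : ℕ, c * T + d ≤ A.totalReward W φ T [] s) : c ≤ A.avgReward W φ s :=
  (tendsto_mul_add_div c d).liminf_eq.symm.trans_le <| liminf_le_liminf
    (.of_forall fun T => div_le_div_of_nonneg_right (h T) T.cast_nonneg)
    (tendsto_mul_add_div c d).isBoundedUnder_ge
    (A.isBoundedUnder_le_totalReward_div W φ s).isCoboundedUnder_ge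

theorem exists_totalReward_le_of_envelope {W c : ℝ} {φ : ArmPolicy K} {y : Fin K → ℕ → ℝ}
    (hbdd : ∀ j, BddBelow (Set.range fun n => y j n - A.passiveReward (W - c) j n))
    (hcycle : A.R1 - c + ∑ k, A.ps k * y k 0 ≤ 0)
    (hpassive : ∀ l j n, φ.act l (j, n.succPNat) ≠ 1 → y j (n + 1) ≤ y j n)
    (hactive : ∀ l j n, φ.act l (j, n.succPNat) ≠ 0 → A.passiveReward (W - c) j n ≤ y j n)
    (s : BeliefState K) : ∃ d, ∀ T : ℕ, A.totalReward W φ T [] s ≤ c * T + d := by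
  choose b hb using hbdd
  obtain ⟨m, hm⟩ := (Set.finite_range b).bddBelow
  let v : BeliefState K → ℝ := fun s => A.R1 - c +
    (y s.1 s.2.natPred - A.passiveReward (W - c) s.1 s.2.natPred)
  have hv (s : BeliefState K) : A.R1 - c + m ≤ v s :=
    add_le_add_right ((hm ⟨s.1, rfl⟩).trans (hb s.1 ⟨s.2.natPred, rfl⟩)) _
  have hbackup (l : List (BeliefState K)) (s : BeliefState K) :
      A.backup W (φ.act l s) v s ≤ c + v s := by
    obtain ⟨j, n, rfl⟩ := s.exists_eq_succPNat
    refine backup_le (φ.act_nonneg _ _) (φ.act_le_one _ _) (fun ha => ?_) fun ha => ?_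
    · change A.R0 j n.succPNat + W + (A.R1 - c + (y j (n + 1) - A.passiveReward (W - c) j (n + 1)))
        ≤ c + (A.R1 - c + (y j n - A.passiveReward (W - c) j n))
      linarith [hpassive l j n ha, A.passiveReward_succ (W - c) j n]
    · change A.R1 + ∑ k, A.ps k * (A.R1 - c + (y k 0 - A.passiveReward (W - c) k 0))
        ≤ c + (A.R1 - c + (y j n - A.passiveReward (W - c) j n))
      simp only [passiveReward_zero, sub_zero, mul_add, sum_add_distrib, ← sum_mul, A.ps_sum,
        one_mul]
      linarith [hactive l j n ha]
  refine ⟨v s - (A.R1 - c + m), fun T => ?_⟩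
  linarith [totalReward_le hv hbackup T [] s]

theorem avgReward_le_of_envelope {W c : ℝ} {φ : ArmPolicy K} {y : Fin K → ℕ → ℝ}
    (hbdd : ∀ j, BddBelow (Set.range fun n => y j n - A.passiveReward (W - c) j n))
    (hcycle : A.R1 - c + ∑ k, A.ps k * y k 0 ≤ 0)
    (hpassive : ∀ l j n, φ.act l (j, n.succPNat) ≠ 1 → y j (n + 1) ≤ y j n)
    (hactive : ∀ l j n, φ.act l (j, n.succPNat) ≠ 0 → A.passiveReward (W - c) j n ≤ y j n)
    (s : BeliefState K) : A.avgReward W φ s ≤ c :=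
  (exists_totalReward_le_of_envelope hbdd hcycle hpassive hactive s).elim fun _ => avgReward_le

theorem le_avgReward_of_envelope {W c : ℝ} {φ : ArmPolicy K} {y : Fin K → ℕ → ℝ}
    (hbdd : ∀ j, BddAbove (Set.range fun n => y j n - A.passiveReward (W - c) j n))
    (hcycle : 0 ≤ A.R1 - c + ∑ k, A.ps k * y k 0)
    (hpassive : ∀ l j n, φ.act l (j, n.succPNat) ≠ 1 → y j n ≤ y j (n + 1))
    (hactive : ∀ l j n, φ.act l (j, n.succPNat) ≠ 0 → y j n ≤ A.passiveReward (W - c) j n)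
    (s : BeliefState K) : c ≤ A.avgReward W φ s := by
  have hF (j : Fin K) (n : ℕ) :
      A.neg.passiveReward (-W - -c) j n = -A.passiveReward (W - c) j n := by
    rw [← passiveReward_neg, neg_sub_neg, neg_sub]
  have hneg : ∃ d, ∀ T : ℕ, A.neg.totalReward (-W) φ T [] s ≤ -c * T + d := by
    refine exists_totalReward_le_of_envelope (y := fun j n => -y j n) (fun j => ?_) ?_
      (fun l j n ha => neg_le_neg (hpassive l j n ha)) (fun l j n ha => ?_) s
    · obtain ⟨b, hb⟩ := hbdd j
      refine ⟨-b, Set.forall_mem_range.2 fun n => ?_⟩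
      linarith [hb ⟨n, rfl⟩, hF j n]
    · simp only [mul_neg, sum_neg_distrib]
      change -A.R1 - -c + -∑ k, A.ps k * y k 0 ≤ 0
      linarith
    · rw [hF]
      exact neg_le_neg (hactive l j n ha)
  obtain ⟨d, hd⟩ := hneg
  refine le_avgReward (d := -d) fun T => ?_
  linarith [hd T, A.totalReward_neg W φ T [] s]

/-! ### The average reward of a threshold policy -/

theorem bddAbove_passiveReward {W c : ℝ} (h : ∀ Γ, A.gain W Γ ≤ c) (j : Fin K) :
    BddAbove (Set.range (A.passiveReward (W - c) j)) := by
  refine ⟨-A.cycleSurplus W c 0 / A.ps j, Set.forall_mem_range.2 fun n => ?_⟩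
  have hn := gain_le_iff.1 (h (Function.update 0 j n))
  rw [cycleSurplus_update, Pi.zero_apply, passiveReward_zero, sub_zero] at hn
  rw [le_div_iff₀' (A.ps_pos j)]
  linarith

theorem sum_iSup_passiveReward_le {W c : ℝ} (h : ∀ Γ, A.gain W Γ ≤ c) :
    A.R1 - c + ∑ k, A.ps k * ⨆ n, A.passiveReward (W - c) k n ≤ 0 := by
  refine le_of_forall_pos_le_add fun ε hε => ?_
  choose Γ hΓ using fun k => exists_lt_of_lt_ciSup
    (sub_lt_self (⨆ n, A.passiveReward (W - c) k n) hε)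
  have hsum : ∑ k, A.ps k * ⨆ n, A.passiveReward (W - c) k n ≤
      ∑ k, A.ps k * A.passiveReward (W - c) k (Γ k) + ε :=
    calc ∑ k, A.ps k * ⨆ n, A.passiveReward (W - c) k n
        ≤ ∑ k, A.ps k * (A.passiveReward (W - c) k (Γ k) + ε) := sum_le_sum fun k _ =>
          mul_le_mul_of_nonneg_left (sub_lt_iff_lt_add.1 (hΓ k)).le (A.ps_pos k).le
      _ = ∑ k, A.ps k * A.passiveReward (W - c) k (Γ k) + ε := by
          simp only [mul_add, sum_add_distrib, ← sum_mul, A.ps_sum, one_mul]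
  have hsurplus := gain_le_iff.1 (h Γ)
  rw [cycleSurplus] at hsurplus
  linarith

theorem avgReward_le_of_forall_gain_le {W c : ℝ} (h : ∀ Γ, A.gain W Γ ≤ c) (φ : ArmPolicy K)
    (s : BeliefState K) : A.avgReward W φ s ≤ c := by
  have hbdd (j : Fin K) (n : ℕ) :
      BddAbove (Set.range fun m => A.passiveReward (W - c) j (n + m)) :=
    (bddAbove_passiveReward h j).mono (Set.range_subset_iff.2 fun m => Set.mem_range_self (n + m))
  have hle (j : Fin K) (n : ℕ) :
      A.passiveReward (W - c) j n ≤ ⨆ m, A.passiveReward (W - c) j (n + m) :=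
    le_ciSup (hbdd j n) 0
  refine avgReward_le_of_envelope (y := fun j n => ⨆ m, A.passiveReward (W - c) j (n + m))
    (fun j => ⟨0, Set.forall_mem_range.2 fun n => sub_nonneg.2 (hle j n)⟩) ?_
    (fun _ j n _ => ciSup_le fun m => ?_) (fun _ j n _ => hle j n) s
  · simpa only [zero_add] using sum_iSup_passiveReward_le h
  · rw [add_assoc]
    exact le_ciSup (hbdd j n) (1 + m)

theorem tendsto_passiveReward_max_sub (A : Arm K) (W : ℝ) (j : Fin K) (N : ℕ) :
    Tendsto (fun n => A.passiveReward W j (max n N) - A.passiveReward W j n) atTop (𝓝 0) :=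
  tendsto_const_nhds.congr' <| (eventually_ge_atTop N).mono fun n hn => by
    simp only [max_eq_left hn, sub_self]

theorem avgReward_toExt (W : ℝ) (Γ : Fin K → ℕ) (s : BeliefState K) :
    A.avgReward W (thresholdPolicy (toExt Γ)) s = A.gain W Γ := by
  set c := A.gain W Γ
  let y : Fin K → ℕ → ℝ := fun j n => A.passiveReward (W - c) j (max n (Γ j))
  have hcycle : A.R1 - c + ∑ k, A.ps k * y k 0 = 0 := by
    simp only [y, Nat.zero_max]
    exact A.cycleSurplus_gain W Γ
  have hpassive (l : List (BeliefState K)) (j : Fin K) (n : ℕ)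
      (h : (thresholdPolicy (toExt Γ)).act l (j, n.succPNat) ≠ 1) : y j (n + 1) = y j n := by
    have hn := isPassive_toExt.1 (act_thresholdPolicy_ne_one.1 h)
    simp only [y, max_eq_right hn.le, max_eq_right (Nat.succ_le_of_lt hn)]
  have hactive (l : List (BeliefState K)) (j : Fin K) (n : ℕ)
      (h : (thresholdPolicy (toExt Γ)).act l (j, n.succPNat) ≠ 0) :
      y j n = A.passiveReward (W - c) j n := by
    have hn := not_lt.1 (isPassive_toExt.not.1 (act_thresholdPolicy_ne_zero.1 h))
    simp only [y, max_eq_left hn]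
  have htendsto (j : Fin K) := A.tendsto_passiveReward_max_sub (W - c) j (Γ j)
  exact le_antisymm
    (avgReward_le_of_envelope (fun j => (htendsto j).bddBelow_range) hcycle.le
      (fun l j n h => (hpassive l j n h).le) (fun l j n h => (hactive l j n h).ge) s)
    (le_avgReward_of_envelope (fun j => (htendsto j).bddAbove_range) hcycle.ge
      (fun l j n h => (hpassive l j n h).ge) (fun l j n h => (hactive l j n h).le) s)

/-- Remaining passive forever after the channel was sensed in state `j` has a nonnegative average
reward when passivity is subsidized by `V`. -/
def PassiveViable (A : Arm K) (j : Fin K) (V : ℝ) : Prop :=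
  ∀ V' > V, ∀ᶠ n in atTop, 0 ≤ A.passiveReward V' j n

theorem PassiveViable.mono {j : Fin K} {V V' : ℝ} (h : A.PassiveViable j V) (hV : V ≤ V') :
    A.PassiveViable j V' :=
  fun U hU => h U (hV.trans_lt hU)

theorem PassiveViable.tendsto_atTop {j : Fin K} {V V' : ℝ} (h : A.PassiveViable j V)
    (hV : V < V') : Tendsto (A.passiveReward V' j) atTop atTop := by
  obtain ⟨U, hVU, hUV'⟩ := exists_between hV
  refine tendsto_atTop_mono' _ ?_
    (tendsto_natCast_atTop_atTop.const_mul_atTop (sub_pos.2 hUV'))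
  filter_upwards [h U hVU] with n hn
  rw [← add_sub_cancel U V', passiveReward_add, add_sub_cancel_left]
  exact le_add_of_nonneg_left hn

theorem PassiveViable.sub_le {j : Fin K} {V W x : ℝ} {Γ : Fin K → ℕ} (h : A.PassiveViable j V)
    (hx : ∀ n ≥ Γ j, A.gain W (Function.update Γ j n) ≤ x) : W - x ≤ V := by
  by_contra! hV
  obtain ⟨n, hsurplus, hn⟩ := (((h.tendsto_atTop hV).eventually_gt_atTop
    (A.passiveReward (W - x) j (Γ j) - A.cycleSurplus W x Γ / A.ps j)).and
      (eventually_ge_atTop (Γ j))).exists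
  have hgain := gain_le_iff.1 (hx n hn)
  rw [cycleSurplus_update] at hgain
  rw [sub_lt_comm, lt_div_iff₀' (A.ps_pos j)] at hsurplus
  linarith

theorem exists_lowerEnvelope {V V' : ℝ} {j : Fin K} {N : ℕ∞} (hV : V < V')
    (h : N = ⊤ → A.PassiveViable j V) :
    ∃ a : ℕ → ℝ, BddAbove (Set.range fun n => a n - A.passiveReward V' j n) ∧
      (∀ n : ℕ, n < N → a n ≤ a (n + 1)) ∧ ∀ n : ℕ, N ≤ n → a n ≤ A.passiveReward V' j n := by
  cases N with
  | top =>
    have hbdd (n : ℕ) : BddBelow (Set.range fun m => A.passiveReward V' j (n + m)) :=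
      (isBoundedUnder_of_eventually_ge (h rfl V' hV)).bddBelow_range.mono
        (Set.range_subset_iff.2 fun m => Set.mem_range_self (n + m))
    refine ⟨fun n => ⨅ m, A.passiveReward V' j (n + m),
      ⟨0, Set.forall_mem_range.2 fun n => sub_nonpos.2 (ciInf_le (hbdd n) 0)⟩,
      fun n _ => le_ciInf fun m => ?_, fun n hn => absurd hn (ENat.natCast_lt_top n).not_ge⟩
    rw [add_assoc]
    exact ciInf_le (hbdd n) (1 + m)
  | coe N =>
    refine ⟨fun n => A.passiveReward V' j (max n N),
      (A.tendsto_passiveReward_max_sub V' j N).bddAbove_range, fun n hn => ?_, fun n hn => ?_⟩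
    · have hn := Nat.cast_lt.1 hn
      simp only [max_eq_right hn.le, max_eq_right (Nat.succ_le_of_lt hn), le_refl]
    · simp only [max_eq_left (Nat.cast_le.1 hn), le_refl]

theorem le_avgReward_of_passiveViable {W c : ℝ} {Γ : Fin K → ℕ∞} (hΓ : ∃ j, Γ j = ⊤)
    (h : ∀ j, Γ j = ⊤ → A.PassiveViable j (W - c)) (s : BeliefState K) :
    c ≤ A.avgReward W (thresholdPolicy Γ) s := by
  classical
  refine le_of_forall_lt_imp_le_of_dense fun c' hc' => ?_
  choose a hbdd hpassive hactive using fun j => exists_lowerEnvelope (sub_lt_sub_left hc' W) (h j)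
  obtain ⟨i, hi⟩ := hΓ
  set x := A.R1 - c' + ∑ k, A.ps k * a k 0
  -- A cycle that never ends need not meet the constraint for the active action, so its envelope can
  -- be raised until the average over the cycles is nonnegative.
  let D : ℝ := |x| / A.ps i
  have hD : 0 ≤ D := div_nonneg (abs_nonneg x) (A.ps_pos i).le
  refine le_avgReward_of_envelope (y := fun j n => a j n + if Γ j = ⊤ then D else 0)
    (fun j => ?_) ?_ (fun l j n hl => ?_) (fun l j n hl => ?_) s
  · obtain ⟨b, hb⟩ := hbdd j
    refine ⟨b + if Γ j = ⊤ then D else 0, Set.forall_mem_range.2 fun n => ?_⟩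
    linarith [hb ⟨n, rfl⟩]
  · have hraise : |x| ≤ ∑ k, A.ps k * if Γ k = ⊤ then D else 0 :=
      calc |x| = A.ps i * if Γ i = ⊤ then D else 0 := by
            rw [if_pos hi, mul_div_cancel₀ _ (A.ps_pos i).ne']
        _ ≤ ∑ k, A.ps k * if Γ k = ⊤ then D else 0 :=
            single_le_sum (f := fun k => A.ps k * if Γ k = ⊤ then D else 0) (fun k _ =>
              mul_nonneg (A.ps_pos k).le (by split_ifs <;> first | exact hD | exact le_rfl))
              (mem_univ i)
    simp only [mul_add, sum_add_distrib, ← add_assoc]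
    linarith [neg_abs_le x]
  · exact add_le_add_left
      (hpassive j n (isPassive_succPNat.1 (act_thresholdPolicy_ne_one.1 hl))) _
  · have hn : Γ j ≤ n := not_lt.1 (isPassive_succPNat.not.1 (act_thresholdPolicy_ne_zero.1 hl))
    rw [if_neg (hn.trans_lt (ENat.natCast_lt_top n)).ne, add_zero]
    exact hactive j n hn

theorem totalReward_of_eq_top (W : ℝ) {Γ : Fin K → ℕ∞} {j : Fin K} (hj : Γ j = ⊤) (T : ℕ)
    (l : List (BeliefState K)) (n : ℕ) :
    A.totalReward W (thresholdPolicy Γ) T l (j, n.succPNat) =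
      A.passiveReward W j (n + T) - A.passiveReward W j n := by
  induction T generalizing l n with
  | zero => simp [totalReward]
  | succ T ih =>
    have hact : (thresholdPolicy Γ).act l (j, n.succPNat) = 0 := by
      simp [thresholdPolicy, IsPassive, hj]
    have hnext := ih ((j, n.succPNat) :: l) (n + 1)
    rw [totalReward, hact, show n.succPNat + 1 = (n + 1).succPNat from rfl, hnext,
      passiveReward_succ, add_right_comm n 1 T, ← add_assoc n T 1]
    ring

theorem PassiveViable.of_le_avgReward {W c : ℝ} {Γ : Fin K → ℕ∞} {j : Fin K} (hj : Γ j = ⊤)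
    (h : c ≤ A.avgReward W (thresholdPolicy Γ) (j, 1)) : A.PassiveViable j (W - c) := by
  intro V hV
  have hlt : W - V < A.avgReward W (thresholdPolicy Γ) (j, 1) :=
    (sub_lt_comm.1 hV).trans_le h
  filter_upwards [eventually_lt_of_lt_liminf hlt (A.isBoundedUnder_ge_totalReward_div W _ _),
    eventually_gt_atTop 0] with n hn hn0
  have htotal := A.totalReward_of_eq_top W hj n [] 0
  rw [zero_add, passiveReward_zero, sub_zero] at htotal
  change _ < A.totalReward W (thresholdPolicy Γ) n [] (j, (0).succPNat) / n at hn
  rw [htotal, lt_div_iff₀ (Nat.cast_pos.2 hn0)] at hn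
  rw [← add_sub_cancel W V, passiveReward_add]
  linarith

/-! ### Optimal threshold policies -/

theorem gain_le_of_forall_le {W v : ℝ} (hactive : A.R1 ≤ v) (hpassive : ∀ j τ, A.R0 j τ + W ≤ v)
    (Γ : Fin K → ℕ) : A.gain W Γ ≤ v := by
  refine gain_le_iff.2 (add_nonpos (sub_nonpos.2 hactive) (sum_nonpos fun k _ => ?_))
  refine mul_nonpos_of_nonneg_of_nonpos (A.ps_pos k).le (sum_nonpos fun r _ => ?_)
  linarith [hpassive k r.succPNat]

theorem bddAbove_gain (A : Arm K) (W : ℝ) : BddAbove (Set.range (A.gain W)) := by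
  obtain ⟨C, hC⟩ := A.R0_bounded
  exact ⟨max A.R1 (C + W), Set.forall_mem_range.2 <| gain_le_of_forall_le (le_max_left _ _)
    fun j τ => (add_le_add_left (le_of_abs_le (hC j τ)) W).trans (le_max_right _ _)⟩

/-- The optimal average reward with subsidy `W`, as a supremum over the threshold policies with
finite thresholds. -/
noncomputable def optGain (A : Arm K) (W : ℝ) : ℝ := ⨆ Γ : Fin K → ℕ, A.gain W Γ

theorem gain_le_optGain (W : ℝ) (Γ : Fin K → ℕ) : A.gain W Γ ≤ A.optGain W :=
  le_ciSup (A.bddAbove_gain W) Γ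

theorem isOptimal_iff {W : ℝ} {Γ : Fin K → ℕ∞} :
    A.IsOptimal W Γ ↔ ∀ s, A.optGain W ≤ A.avgReward W (thresholdPolicy Γ) s :=
  ⟨fun h s => ciSup_le fun Γ' => (avgReward_toExt W Γ' s).symm.trans_le (h _ s),
    fun h φ s => (avgReward_le_of_forall_gain_le (gain_le_optGain W) φ s).trans (h s)⟩

theorem isOptimal_toExt_iff {W : ℝ} {Γ : Fin K → ℕ} :
    A.IsOptimal W (toExt Γ) ↔ A.gain W Γ = A.optGain W := by
  have := A.nonempty_channelState
  simp only [isOptimal_iff, avgReward_toExt, forall_const]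
  exact (gain_le_optGain W Γ).ge_iff_eq

/-- The subsidy that remains of `W` after the optimal average reward is charged in every slot. -/
noncomputable def netSubsidy (A : Arm K) (W : ℝ) : ℝ := W - A.optGain W

theorem netSubsidy_le (W : ℝ) (Γ : Fin K → ℕ) : A.netSubsidy W ≤ W - A.gain W Γ :=
  sub_le_sub_left (gain_le_optGain W Γ) W

theorem netSubsidy_monotone (A : Arm K) : Monotone A.netSubsidy := fun _ _ h =>
  le_sub_comm.1 <| ciSup_le fun Γ =>
    le_sub_comm.1 ((netSubsidy_le _ Γ).trans ((A.sub_gain_strictMono Γ).monotone h))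

theorem IsOptimal.netSubsidy_lt {W W' : ℝ} {Γ : Fin K → ℕ} (hΓ : A.IsOptimal W' (toExt Γ))
    (h : W < W') : A.netSubsidy W < A.netSubsidy W' :=
  calc A.netSubsidy W ≤ W - A.gain W Γ := netSubsidy_le W Γ
    _ < W' - A.gain W' Γ := A.sub_gain_strictMono Γ h
    _ = A.netSubsidy W' := by rw [isOptimal_toExt_iff.1 hΓ, netSubsidy]

theorem isOptimal_iff_of_eq_top {W : ℝ} {Γ : Fin K → ℕ∞} (hΓ : ∃ j, Γ j = ⊤) :
    A.IsOptimal W Γ ↔ ∀ j, Γ j = ⊤ → A.PassiveViable j (A.netSubsidy W) :=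
  isOptimal_iff.trans
    ⟨fun h j hj => .of_le_avgReward hj (h (j, 1)), le_avgReward_of_passiveViable hΓ⟩

theorem IsOptimal.passiveReward_le {W : ℝ} {Γ : Fin K → ℕ} (h : A.IsOptimal W (toExt Γ))
    (j : Fin K) (n : ℕ) :
    A.passiveReward (A.netSubsidy W) j n ≤ A.passiveReward (A.netSubsidy W) j (Γ j) := by
  have hupdate := gain_le_iff.1 (A.gain_le_optGain W (Function.update Γ j n))
  rw [cycleSurplus_update, ← isOptimal_toExt_iff.1 h, cycleSurplus_gain, zero_add,
    isOptimal_toExt_iff.1 h] at hupdate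
  exact sub_nonpos.1 (nonpos_of_mul_nonpos_right hupdate (A.ps_pos j))

theorem IsOptimal.of_passiveReward_le {W : ℝ} {Γ Γ' : Fin K → ℕ} (h : A.IsOptimal W (toExt Γ))
    (hle : ∀ k, A.passiveReward (A.netSubsidy W) k (Γ k) ≤
      A.passiveReward (A.netSubsidy W) k (Γ' k)) : A.IsOptimal W (toExt Γ') := by
  refine isOptimal_toExt_iff.2 ((gain_le_optGain W Γ').antisymm (le_gain_iff.2 ?_))
  calc 0 ≤ A.cycleSurplus W (A.optGain W) Γ := le_gain_iff.1 (isOptimal_toExt_iff.1 h).ge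
    _ ≤ A.cycleSurplus W (A.optGain W) Γ' := add_le_add_right (sum_le_sum fun k _ =>
        mul_le_mul_of_nonneg_left (hle k) (A.ps_pos k).le) _

theorem IsOptimal.sup {W : ℝ} {Γ Γ' : Fin K → ℕ} (h : A.IsOptimal W (toExt Γ))
    (h' : A.IsOptimal W (toExt Γ')) : A.IsOptimal W (toExt (Γ ⊔ Γ')) :=
  h.of_passiveReward_le fun k => by
    rcases le_total (Γ k) (Γ' k) with hk | hk
    · simpa only [Pi.sup_apply, sup_of_le_right hk] using h'.passiveReward_le k (Γ k)
    · simp only [Pi.sup_apply, sup_of_le_left hk, le_refl]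

/-! ### Dependence on the subsidy -/

theorem IsOptimal.le_of_lt {W W' : ℝ} {Γ : Fin K → ℕ∞} {Γ' : Fin K → ℕ}
    (hΓ : A.IsOptimal W Γ) (hΓ' : A.IsOptimal W' (toExt Γ')) (h : W < W') : Γ ≤ toExt Γ' := by
  have hnet : A.netSubsidy W < A.netSubsidy W' := hΓ'.netSubsidy_lt h
  rcases exists_eq_toExt_or_exists_eq_top Γ with ⟨Γ, rfl⟩ | ⟨j, hj⟩
  · refine toExt_le_toExt.2 fun j => ?_
    by_contra! hlt
    have hgap := mul_lt_mul_of_pos_left (Nat.cast_lt (α := ℝ).2 hlt) (sub_pos.2 hnet)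
    have hW := hΓ.passiveReward_le j (Γ' j)
    have hW' := hΓ'.passiveReward_le j (Γ j)
    rw [← add_sub_cancel (A.netSubsidy W) (A.netSubsidy W'), passiveReward_add,
      passiveReward_add] at hW'
    linarith
  · have hviable := (isOptimal_iff_of_eq_top ⟨j, hj⟩).1 hΓ j hj
    exact absurd hnet (hviable.sub_le (Γ := 0) fun n _ => gain_le_optGain W' _).not_gt

theorem IsOptimal.of_eq_top {W W' : ℝ} {Γ : Fin K → ℕ∞} (hΓ : A.IsOptimal W Γ)
    (htop : ∃ j, Γ j = ⊤) (h : W ≤ W') : A.IsOptimal W' Γ :=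
  (isOptimal_iff_of_eq_top htop).2 fun j hj =>
    ((isOptimal_iff_of_eq_top htop).1 hΓ j hj).mono (A.netSubsidy_monotone h)

theorem IsOptimal.toExt_sup {W : ℝ} {Γ : Fin K → ℕ∞} (hΓ : A.IsOptimal W Γ)
    (htop : ∃ j, Γ j = ⊤) (Γ' : Fin K → ℕ) : A.IsOptimal W (toExt Γ' ⊔ Γ) := by
  have htop' : ∃ j, (toExt Γ' ⊔ Γ) j = ⊤ :=
    htop.imp fun j hj => by rw [Pi.sup_apply, hj, sup_top_eq]
  refine (isOptimal_iff_of_eq_top htop').2 fun k hk =>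
    (isOptimal_iff_of_eq_top htop).1 hΓ k ?_
  exact (max_eq_top.1 hk).resolve_left (ENat.natCast_ne_top _)

theorem ThresholdOptimal.indexable (hA : A.ThresholdOptimal) : A.Indexable := by
  intro W W' h Γ hΓ
  simp only [passiveSet_subset_passiveSet]
  refine ⟨?_, fun Γ' hΓ' => hΓ.le_of_lt hΓ' h⟩
  rcases exists_eq_toExt_or_exists_eq_top Γ with ⟨Γ, rfl⟩ | htop
  · obtain ⟨Γ', hΓ'⟩ := hA W'
    rcases exists_eq_toExt_or_exists_eq_top Γ' with ⟨Γ', rfl⟩ | htop'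
    · exact ⟨_, hΓ', hΓ.le_of_lt hΓ' h⟩
    · exact ⟨_, hΓ'.toExt_sup htop' Γ, le_sup_left⟩
  · exact ⟨Γ, hΓ.of_eq_top htop h.le, le_rfl⟩

/-! ### A step of the algorithm -/

theorem stepRatios_toExt (Γ : Fin K → ℕ) :
    A.stepRatios (toExt Γ) = A.ratio Γ '' Set.Ioi Γ := by
  simp [stepRatios, largerThresholds, toExt_lt_toExt, toExt, Set.Ioi]

theorem stepRatios_nonempty (A : Arm K) (Γ : Fin K → ℕ) : (A.stepRatios (toExt Γ)).Nonempty := by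
  have := A.nonempty_channelState
  rw [stepRatios_toExt]
  exact Set.nonempty_Ioi.image _

theorem mem_lowerBounds_stepRatios_iff {W : ℝ} {Γ : Fin K → ℕ} :
    W ∈ lowerBounds (A.stepRatios (toExt Γ)) ↔ ∀ Γ' > Γ, A.gain W Γ' ≤ A.gain W Γ := by
  rw [stepRatios_toExt, mem_lowerBounds, Set.forall_mem_image]
  exact forall₂_congr fun Γ' h => le_ratio_iff h

theorem IsOptimal.mem_lowerBounds_stepRatios {W : ℝ} {Γ : Fin K → ℕ}
    (h : A.IsOptimal W (toExt Γ)) : W ∈ lowerBounds (A.stepRatios (toExt Γ)) :=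
  mem_lowerBounds_stepRatios_iff.2 fun Γ' _ => isOptimal_toExt_iff.1 h ▸ gain_le_optGain W Γ'

theorem IsOptimal.isGLB_stepValue {W : ℝ} {Γ : Fin K → ℕ} (h : A.IsOptimal W (toExt Γ)) :
    IsGLB (A.stepRatios (toExt Γ)) (A.stepValue (toExt Γ)) :=
  isGLB_csInf (A.stepRatios_nonempty Γ) ⟨W, h.mem_lowerBounds_stepRatios⟩

theorem IsOptimal.of_mem_lowerBounds_stepRatios (hA : A.ThresholdOptimal) {W W' : ℝ}
    {Γ : Fin K → ℕ} (hΓ : A.IsOptimal W (toExt Γ)) (h : W ≤ W')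
    (hW' : W' ∈ lowerBounds (A.stepRatios (toExt Γ))) : A.IsOptimal W' (toExt Γ) := by
  rcases h.eq_or_lt with rfl | h
  · exact hΓ
  have hle (Γ' : Fin K → ℕ) (hΓ' : Γ ≤ Γ') : A.gain W' Γ' ≤ A.gain W' Γ :=
    hΓ'.eq_or_lt.elim (fun heq => heq ▸ le_rfl) (mem_lowerBounds_stepRatios_iff.1 hW' Γ')
  refine isOptimal_toExt_iff.2 ((gain_le_optGain W' Γ).antisymm ?_)
  obtain ⟨Γ', hΓ'⟩ := hA W'
  rcases exists_eq_toExt_or_exists_eq_top Γ' with ⟨Γ', rfl⟩ | ⟨j, hj⟩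
  · rw [← isOptimal_toExt_iff.1 hΓ']
    exact hle Γ' (toExt_le_toExt.1 (hΓ.le_of_lt hΓ' h))
  · have hviable := (isOptimal_iff_of_eq_top ⟨j, hj⟩).1 hΓ' j hj
    exact (sub_le_sub_iff_left W').1
      (hviable.sub_le fun n hn => hle _ (le_update_self_iff.2 hn))

theorem IsOptimal.isGreatest_stepValue (hA : A.ThresholdOptimal) {W : ℝ} {Γ : Fin K → ℕ}
    (h : A.IsOptimal W (toExt Γ)) :
    IsGreatest {W' | A.IsOptimal W' (toExt Γ)} (A.stepValue (toExt Γ)) :=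
  ⟨h.of_mem_lowerBounds_stepRatios hA (h.isGLB_stepValue.2 h.mem_lowerBounds_stepRatios)
      h.isGLB_stepValue.1,
    fun _ hW' => h.isGLB_stepValue.2 hW'.mem_lowerBounds_stepRatios⟩

theorem IsOptimal.mem_minimizers_iff (hA : A.ThresholdOptimal) {W : ℝ} {Γ Γ' : Fin K → ℕ}
    (h : A.IsOptimal W (toExt Γ)) :
    Γ' ∈ A.minimizers (toExt Γ) ↔ Γ < Γ' ∧ A.IsOptimal (A.stepValue (toExt Γ)) (toExt Γ') := by
  rw [isOptimal_toExt_iff, ← isOptimal_toExt_iff.1 (h.isGreatest_stepValue hA).1]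
  refine Iff.trans ?_ (and_congr_right fun hlt => ratio_eq_iff hlt)
  simp [minimizers, largerThresholds, toExt_lt_toExt, toExt]

theorem IsOptimal.supClosed_minimizers (hA : A.ThresholdOptimal) {W : ℝ} {Γ : Fin K → ℕ}
    (h : A.IsOptimal W (toExt Γ)) : SupClosed (A.minimizers (toExt Γ)) := by
  intro Γ₁ h₁ Γ₂ h₂
  rw [h.mem_minimizers_iff hA] at *
  exact ⟨h₁.1.trans_le le_sup_left, h₁.2.sup h₂.2⟩

theorem toExt_le_nextThreshold {Γ : Fin K → ℕ∞} {Γ' : Fin K → ℕ} (h : Γ' ∈ A.minimizers Γ) :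
    toExt Γ' ≤ A.nextThreshold Γ :=
  (le_iSup₂ (f := fun Γ' (_ : Γ' ∈ A.minimizers Γ) => toExt Γ') Γ' h).trans le_sup_right

theorem le_nextThreshold (A : Arm K) (Γ : Fin K → ℕ∞) : Γ ≤ A.nextThreshold Γ :=
  le_sup_left

theorem exists_mem_minimizers_le {Γ : Fin K → ℕ∞} {j : Fin K} {n : ℕ}
    (hlt : Γ j < n) (hle : n ≤ A.nextThreshold Γ j) : ∃ Γ' ∈ A.minimizers Γ, n ≤ Γ' j := by
  by_contra! h
  cases n with
  | zero => exact not_lt_zero hlt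
  | succ n =>
    have hbound : A.nextThreshold Γ j ≤ n := by
      simp only [nextThreshold, Pi.sup_apply, iSup_apply, sup_le_iff, iSup_le_iff]
      exact ⟨Order.le_of_lt_add_one hlt, fun Γ' hΓ' => Nat.cast_le.2 (Nat.le_of_lt_succ (h Γ' hΓ'))⟩
    exact (hle.trans hbound).not_gt (Nat.cast_lt.2 n.lt_succ_self)

theorem IsOptimal.isOptimal_nextThreshold (hA : A.ThresholdOptimal) {W : ℝ} {Γ Γ' : Fin K → ℕ}
    (hΓ : A.IsOptimal W (toExt Γ)) (h : A.nextThreshold (toExt Γ) = toExt Γ') :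
    A.IsOptimal (A.stepValue (toExt Γ)) (toExt Γ') := by
  refine (hΓ.isGreatest_stepValue hA).1.of_passiveReward_le fun k => ?_
  rcases (toExt_le_toExt.1 (h ▸ A.le_nextThreshold (toExt Γ)) k).eq_or_lt with hk | hk
  · rw [hk]
  · obtain ⟨Γ₁, hΓ₁, hk₁⟩ := exists_mem_minimizers_le (A := A) (Γ := toExt Γ) (Nat.cast_lt.2 hk)
      (congrFun h k).ge
    rw [← (toExt_le_toExt.1 (h ▸ toExt_le_nextThreshold hΓ₁) k).antisymm hk₁]
    exact ((hΓ.mem_minimizers_iff hA).1 hΓ₁).2.passiveReward_le k (Γ k)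

theorem IsOptimal.isGreatest_nextThreshold (hA : A.ThresholdOptimal) {W : ℝ} {Γ Γ' : Fin K → ℕ}
    (hΓ : A.IsOptimal W (toExt Γ)) (hne : (A.minimizers (toExt Γ)).Nonempty)
    (h : A.nextThreshold (toExt Γ) = toExt Γ') : IsGreatest (A.minimizers (toExt Γ)) Γ' := by
  have hub : Γ' ∈ upperBounds (A.minimizers (toExt Γ)) := fun Γ₁ hΓ₁ =>
    toExt_le_toExt.1 (h ▸ toExt_le_nextThreshold hΓ₁)
  obtain ⟨Γ₁, hΓ₁⟩ := hne
  exact ⟨(hΓ.mem_minimizers_iff hA).2 ⟨((hΓ.mem_minimizers_iff hA).1 hΓ₁).1.trans_le (hub hΓ₁),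
    hΓ.isOptimal_nextThreshold hA h⟩, hub⟩

theorem ne_top_of_mem_minimizers {Γ : Fin K → ℕ∞} {Γ' : Fin K → ℕ} (h : Γ' ∈ A.minimizers Γ)
    (j : Fin K) : Γ j ≠ ⊤ :=
  have hlt : Γ < toExt Γ' := h.1
  ((hlt.le j).trans_lt (ENat.natCast_lt_top _)).ne

/-! ### The algorithm -/

theorem exists_isOptimal_zero (A : Arm K) : ∃ W, A.IsOptimal W (toExt 0) := by
  obtain ⟨C, hC⟩ := A.R0_bounded
  have hzero : A.gain (A.R1 - C) 0 = A.R1 := by simp [gain, cycleLength]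
  refine ⟨A.R1 - C, isOptimal_toExt_iff.2 ((gain_le_optGain _ 0).antisymm (ciSup_le ?_))⟩
  refine gain_le_of_forall_le hzero.ge fun j τ => ?_
  linarith [le_of_abs_le (hC j τ)]

theorem exists_isOptimal_algThreshold (hA : A.ThresholdOptimal) (i : ℕ) :
    (∀ j, A.algThreshold i j ≠ ⊤) →
      ∃ (Γ : Fin K → ℕ) (W : ℝ), A.algThreshold i = toExt Γ ∧ A.IsOptimal W (toExt Γ) := by
  induction i with
  | zero => exact fun _ => ⟨0, A.exists_isOptimal_zero.imp fun W hW => ⟨rfl, hW⟩⟩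
  | succ i ih =>
    intro hfin
    obtain ⟨Γ', hΓ'⟩ := exists_eq_toExt hfin
    obtain ⟨Γ, W, hΓ, hopt⟩ := ih fun j =>
      ((A.le_nextThreshold _ j).trans_lt (lt_top_iff_ne_top.2 (hfin j))).ne
    rw [algThreshold, hΓ] at hΓ'
    exact ⟨Γ', _, by rw [algThreshold, hΓ, hΓ'], hopt.isOptimal_nextThreshold hA hΓ'⟩

theorem isWhittleIndex_of_assignedAt (hA : A.ThresholdOptimal) {i : ℕ} {s : BeliefState K}
    (h : A.AssignedAt i s) : A.IsWhittleIndex s (A.algValue i) := by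
  obtain ⟨Γ', hΓ', hpassive⟩ := exists_mem_minimizers_le h.1 h.2
  obtain ⟨Γ, W, hΓ, hopt⟩ := exists_isOptimal_algThreshold hA i (ne_top_of_mem_minimizers hΓ')
  have hactive : ¬ IsPassive (toExt Γ) s := hΓ ▸ h.1.not_ge
  rw [hΓ] at hΓ'
  rw [algValue, hΓ]
  have hstep := (hopt.isGreatest_stepValue hA).1
  refine ⟨⟨⟨toExt Γ', ((hopt.mem_minimizers_iff hA).1 hΓ').2, Nat.cast_le.2 hpassive⟩,
    toExt Γ, hstep, hactive⟩, fun W' hW' => not_lt.1 fun hlt => ?_⟩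
  obtain ⟨Γ₁, hΓ₁, hpassive₁⟩ := hW'.1
  exact hactive (hpassive₁.trans (hΓ₁.le_of_lt hstep hlt s.1))

theorem exists_assignedAt {i : ℕ} (h : ∀ j, A.algThreshold (i + 1) j = ⊤) (s : BeliefState K) :
    ∃ i' ≤ i, A.AssignedAt i' s := by
  classical
  have hs : ((s.2 : ℕ) : ℕ∞) ≤ A.algThreshold (i + 1) s.1 := (h s.1).symm ▸ le_top
  have hex : ∃ m, ((s.2 : ℕ) : ℕ∞) ≤ A.algThreshold (m + 1) s.1 := ⟨i, hs⟩
  refine ⟨Nat.find hex, Nat.find_min' hex hs, ?_, Nat.find_spec hex⟩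
  cases hm : Nat.find hex with
  | zero => exact Nat.cast_pos.2 s.2.pos
  | succ m => exact not_le.1 (Nat.find_min hex (hm ▸ m.lt_succ_self))

/-! ### Antitone passive rewards -/

theorem passiveReward_le_of_le {V : ℝ} {j : Fin K} (hR : Antitone (A.R0 j)) {n m : ℕ}
    (hn : A.R0 j n.succPNat + V ≤ 0) (h : n ≤ m) :
    A.passiveReward V j m ≤ A.passiveReward V j n := by
  induction m, h using Nat.le_induction with
  | base => exact le_rfl
  | succ m hm ih =>
    rw [passiveReward_succ]
    linarith [hR (Nat.succPNat_le_succPNat.2 hm)]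

theorem passiveReward_le_of_ge {V : ℝ} {j : Fin K} {n m : ℕ}
    (hn : ∀ r < n, 0 ≤ A.R0 j r.succPNat + V) (h : m ≤ n) :
    A.passiveReward V j m ≤ A.passiveReward V j n :=
  sum_le_sum_of_subset_of_nonneg (range_subset_range.2 h) fun r hr _ => hn r (mem_range.1 hr)

theorem PassiveViable.nonneg_of_antitone {j : Fin K} {V : ℝ} (h : A.PassiveViable j V)
    (hR : Antitone (A.R0 j)) (n : ℕ) : 0 ≤ A.R0 j n.succPNat + V := by
  by_contra! hneg
  have hlt : V < -A.R0 j n.succPNat := by linarith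
  obtain ⟨V', hV, hV'⟩ := exists_between hlt
  obtain ⟨m, hlt, hm⟩ := (((h.tendsto_atTop hV).eventually_gt_atTop
    (A.passiveReward V' j n)).and (eventually_ge_atTop n)).exists
  exact hlt.not_ge (passiveReward_le_of_le hR (by linarith) hm)

/-- The threshold policy that is passive as long as the passive reward is at least the optimal
average reward. -/
noncomputable def rewardThreshold (A : Arm K) (W : ℝ) (j : Fin K) : ℕ∞ :=
  ⨅ (n : ℕ) (_ : A.R0 j n.succPNat + A.netSubsidy W < 0), (n : ℕ∞)

theorem rewardThreshold_monotone (A : Arm K) : Monotone A.rewardThreshold := fun _ _ h _ =>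
  le_iInf₂ fun n hn => iInf₂_le n ((add_le_add_right (A.netSubsidy_monotone h) _).trans_lt hn)

theorem natCast_lt_rewardThreshold_iff {W : ℝ} {j : Fin K} (hR : Antitone (A.R0 j)) {n : ℕ} :
    n < A.rewardThreshold W j ↔ 0 ≤ A.R0 j n.succPNat + A.netSubsidy W := by
  refine ⟨fun h => not_lt.1 fun hn => h.not_ge (iInf₂_le n hn), fun h => ?_⟩
  refine (ENat.add_one_le_iff (ENat.natCast_ne_top n)).1 (le_iInf₂ fun m hm => ?_)
  have hnm : n < m := not_le.1 fun hmn => by linarith [hR (Nat.succPNat_le_succPNat.2 hmn)]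
  exact_mod_cast hnm

theorem isOptimal_rewardThreshold (hA : A.ThresholdOptimal) (hR : ∀ j, Antitone (A.R0 j))
    (W : ℝ) : A.IsOptimal W (A.rewardThreshold W) := by
  rcases exists_eq_toExt_or_exists_eq_top (A.rewardThreshold W) with ⟨Γ, hΓ⟩ | htop
  · have hlt (j : Fin K) (n : ℕ) : n < Γ j ↔ 0 ≤ A.R0 j n.succPNat + A.netSubsidy W := by
      rw [← natCast_lt_rewardThreshold_iff (hR j), hΓ]
      exact Nat.cast_lt.symm
    obtain ⟨Γ', hΓ'⟩ := hA W
    rcases exists_eq_toExt_or_exists_eq_top Γ' with ⟨Γ', rfl⟩ | ⟨j, hj⟩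
    · rw [hΓ]
      refine hΓ'.of_passiveReward_le fun k => ?_
      rcases le_total (Γ k) (Γ' k) with hk | hk
      · exact passiveReward_le_of_le (hR k)
          (not_le.1 ((hlt k (Γ k)).not.1 (lt_irrefl _))).le hk
      · exact passiveReward_le_of_ge (fun r => (hlt k r).1) hk
    · have hviable := (isOptimal_iff_of_eq_top ⟨j, hj⟩).1 hΓ' j hj
      exact absurd ((hlt j (Γ j)).2 (hviable.nonneg_of_antitone (hR j) _)) (lt_irrefl _)
  · refine (isOptimal_iff_of_eq_top htop).2 fun j hj V hV => .of_forall fun n =>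
      sum_nonneg fun r _ => ?_
    have hr := (natCast_lt_rewardThreshold_iff (hR j)).1 (hj ▸ ENat.natCast_lt_top r)
    linarith

theorem IsOptimal.exists_gt (hA : A.ThresholdOptimal) (hR : ∀ j, Antitone (A.R0 j)) {W : ℝ}
    {Γ : Fin K → ℕ} (hΓ : A.IsOptimal W (toExt Γ))
    (hneg : ∀ j, A.R0 j (Γ j).succPNat + A.netSubsidy W < 0) :
    ∃ W' > W, A.IsOptimal W' (toExt Γ) := by
  have hcont (j : Fin K) :
      Continuous fun W' => A.R0 j (Γ j).succPNat + (W' - A.gain W' Γ) := by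
    simp only [gain_eq_meanReward_add]
    fun_prop
  have hnear : ∀ᶠ W' in 𝓝[>] W, ∀ j, A.R0 j (Γ j).succPNat + (W' - A.gain W' Γ) < 0 :=
    eventually_all.2 fun j => nhdsWithin_le_nhds <|
      ((hcont j).tendsto W).eventually_lt_const (by rw [isOptimal_toExt_iff.1 hΓ]; exact hneg j)
  obtain ⟨W', hW', hlt⟩ := (hnear.and self_mem_nhdsWithin).exists
  have hle : A.rewardThreshold W' ≤ toExt Γ := fun j => by
    refine not_lt.1 ((natCast_lt_rewardThreshold_iff (hR j)).not.2 (not_le.2 ?_))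
    exact (add_le_add_right (netSubsidy_le W' Γ) _).trans_lt (hW' j)
  have hopt := isOptimal_rewardThreshold hA hR W'
  obtain ⟨Γ', hΓ'⟩ := exists_eq_toExt fun j => ((hle j).trans_lt (ENat.natCast_lt_top _)).ne
  rw [hΓ'] at hle hopt
  exact ⟨W', hlt, hle.antisymm (hΓ.le_of_lt hopt hlt) ▸ hopt⟩

theorem IsOptimal.nonempty_minimizers (hA : A.ThresholdOptimal) (hR : ∀ j, Antitone (A.R0 j))
    {W : ℝ} {Γ : Fin K → ℕ} (hΓ : A.IsOptimal W (toExt Γ)) :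
    (A.minimizers (toExt Γ)).Nonempty := by
  have hgreatest := hΓ.isGreatest_stepValue hA
  obtain ⟨j, hj⟩ : ∃ j, 0 ≤ A.R0 j (Γ j).succPNat + A.netSubsidy (A.stepValue (toExt Γ)) := by
    by_contra! hneg
    obtain ⟨W', hlt, hW'⟩ := IsOptimal.exists_gt hA hR hgreatest.1 hneg
    exact (hgreatest.2 hW').not_gt hlt
  refine ⟨Function.update Γ j (Γ j + 1), (hΓ.mem_minimizers_iff hA).2
    ⟨lt_update_self_iff.2 (Nat.lt_succ_self _), hgreatest.1.of_passiveReward_le fun k => ?_⟩⟩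
  rcases eq_or_ne k j with rfl | hk
  · rw [Function.update_self, passiveReward_succ]
    exact le_add_of_nonneg_right hj
  · rw [Function.update_of_ne hk]

end Arm

theorem theorem3 {N K : ℕ} (arm : Fin N → Arm K)
    (h_threshold : ∀ n, (arm n).ThresholdOptimal)
    (h_mono : ∀ n, Monotone (arm n).passiveProb) :
    ProblemIndexable arm ∧
    ∀ n,
      -- the value computed in a step is the Whittle index of the states assigned in that step
      (∀ i s, (arm n).AssignedAt i s → (arm n).IsWhittleIndex s ((arm n).algValue i)) ∧
      -- if all thresholds are infinite after some step, then all states have been assigned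
      (∀ i, (∀ j, (arm n).algThreshold (i + 1) j = ⊤) →
        ∀ s, ∃ i' ≤ i, (arm n).AssignedAt i' s ∧
          (arm n).IsWhittleIndex s ((arm n).algValue i')) ∧
      -- each step that starts from finite thresholds is well defined: the infimum is a true one,
      -- and the supremum of the minimizers is the largest minimizer
      (∀ i, (∀ j, (arm n).algThreshold i j ≠ ⊤) →
        ((arm n).stepRatios ((arm n).algThreshold i)).Nonempty ∧
        IsGLB ((arm n).stepRatios ((arm n).algThreshold i)) ((arm n).algValue i) ∧
        SupClosed ((arm n).minimizers ((arm n).algThreshold i)) ∧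
        ∀ Γ : Fin K → ℕ, ((arm n).minimizers ((arm n).algThreshold i)).Nonempty →
          (arm n).algThreshold (i + 1) = toExt Γ →
          IsGreatest ((arm n).minimizers ((arm n).algThreshold i)) Γ) ∧
      -- if the passive reward does not increase with the age of the information, then the optimal
      -- thresholds can be chosen monotone in the subsidy, and the infimum is always attained
      ((∀ j, Antitone ((arm n).R0 j)) →
        (∃ Γ : ℝ → Fin K → ℕ∞, Monotone Γ ∧ ∀ W, (arm n).IsOptimal W (Γ W)) ∧
        ∀ i, (∀ j, (arm n).algThreshold i j ≠ ⊤) →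
          ((arm n).minimizers ((arm n).algThreshold i)).Nonempty) := by
  refine ⟨fun n => (h_threshold n).indexable, fun n => ?_⟩
  have hA := h_threshold n
  refine ⟨fun i s h => Arm.isWhittleIndex_of_assignedAt hA h, fun i h s => ?_, fun i hi => ?_,
    fun hR => ⟨⟨_, (arm n).rewardThreshold_monotone, Arm.isOptimal_rewardThreshold hA hR⟩,
      fun i hi => ?_⟩⟩
  · obtain ⟨i', hi', h'⟩ := Arm.exists_assignedAt h s
    exact ⟨i', hi', h', Arm.isWhittleIndex_of_assignedAt hA h'⟩
  · obtain ⟨Γ, W, hΓ, hopt⟩ := Arm.exists_isOptimal_algThreshold hA i hi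
    rw [Arm.algValue, Arm.algThreshold, hΓ]
    exact ⟨(arm n).stepRatios_nonempty Γ, hopt.isGLB_stepValue, hopt.supClosed_minimizers hA,
      fun _ => hopt.isGreatest_nextThreshold hA⟩
  · obtain ⟨Γ, W, hΓ, hopt⟩ := Arm.exists_isOptimal_algThreshold hA i hi
    exact hΓ ▸ hopt.nonempty_minimizers hA hR
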